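/- Let $V$ be a finite-dimensional Euclidean vector space and let $W\subset \mathrm{O}(V)$ be a finite reflection group (a finite subgroup generated by orthogonal reflections at hyperplanes) that is almost irreducible: $V=V_1\oplus V_2$ with $W$-invariant subspaces $V_1,V_2$ such that $W$ acts irreducibly and nontrivially on $V_1$ and trivially on $V_2$, and $\dim V_2=1$. Let $C\subset V$ be a monoconditional symmetric cone, i.e. a $W$-invariant convex polyhedral cone for which there is a linear form $\phi\in V^*$ with $V_1\not\subset\ker\phi$, $V_2\not\subset\ker\phi$ and \[ C=\{x\in V \mid \phi(\sigma x)\ge 0 \text{ for all } \sigma\in W\}. \] Let $F\subset V$ be a fundamental domain for $W$, i.e. the closure of an open set that meets every $W$-orbit in exactly one point; such an $F$ is a full-dimensional polyhedral cone. Let $H_1,\dots,H_r$ be the distinct facet hyperplanes of $F$ (hyperplanes $H$ such that $F$ lies in one closed half-space bounded by $H$ and $F\cap H$ spans $H$), in any order, and let $s_j$ be the orthogonal reflection at $H_j$. For $\sigma\in W$ let $l(\sigma)$ be the smallest length of a word in $s_1,\dots,s_r$ with product $\sigma$, and let \[ \mathrm{Des}_R(\sigma)=\{j\in\{1,\dots,r\}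 \mid l(\sigma s_j)<l(\sigma)\}. \] For $J\subset\{1,\dots,r\}$ put $C_+=C\cap F$ and $C_J=C_+\setminus\bigcup_{j\in J}H_j$. Then \[ C=\bigcup_{\sigma\in W}\sigma\, C_{\mathrm{Des}_R(\sigma)}, \] and the sets $\sigma\, C_{\mathrm{Des}_R(\sigma)}$, $\sigma\in W$, are pairwise disjoint. -/

import Mathlib

open Set

section Coxeter

/-- The length of `g` with respect to a family of generators `s`: the smallest length of a word in
the `s j` whose product is `g`. The infimum is a minimum as soon as `g` is such a product. -/
noncomputable def wordLength {G ι : Type*} [Group G] (s : ι → G) (g : G) : ℕ :=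
  sInf {k | ∃ l : List ι, l.length = k ∧ (l.map s).prod = g}

/-- The right descent set of `g` with respect to the generators `s`. -/
def rightDescentSet {G ι : Type*} [Group G] (s : ι → G) (g : G) : Set ι :=
  {j | wordLength s (g * s j) < wordLength s g}

end Coxeter

section Reflection

variable {V : Type*} [NormedAddCommGroup V] [InnerProductSpace ℝ V] [FiniteDimensional ℝ V]

/-- A hyperplane: a linear subspace of codimension one. -/
def IsHyperplane (H : Submodule ℝ V) : Prop :=
  Module.finrank ℝ H + 1 = Module.finrank ℝ V

/-- A finite reflection group in `O(V)`: a finite subgroup of the orthogonal group that is generated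
by the orthogonal reflections at hyperplanes which it contains. -/
def IsFiniteReflectionGroup (W : Subgroup (V ≃ₗᵢ[ℝ] V)) : Prop :=
  Finite W ∧
    Subgroup.closure {g | g ∈ W ∧ ∃ H : Submodule ℝ V, IsHyperplane H ∧ g = H.reflection} = W

/-- A subspace that is mapped into itself by every element of `W`. -/
def IsInvariantSubspace (W : Subgroup (V ≃ₗᵢ[ℝ] V)) (U : Submodule ℝ V) : Prop :=
  ∀ σ ∈ W, ∀ x ∈ U, σ x ∈ U

/-- `V = V₁ ⊕ V₂` is a decomposition which exhibits the finite reflection group `W` as almost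
irreducible: both summands are invariant, `W` acts irreducibly and nontrivially on `V₁`, it acts
trivially on `V₂`, and `V₂` is one-dimensional. -/
structure IsAlmostIrreducible (W : Subgroup (V ≃ₗᵢ[ℝ] V)) (V₁ V₂ : Submodule ℝ V) : Prop where
  reflectionGroup : IsFiniteReflectionGroup W
  isCompl : IsCompl V₁ V₂
  invariant_fst : IsInvariantSubspace W V₁
  invariant_snd : IsInvariantSubspace W V₂
  ne_bot : V₁ ≠ ⊥
  irreducible : ∀ U : Submodule ℝ V, U ≤ V₁ → IsInvariantSubspace W U → U = ⊥ ∨ U = V₁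
  nontrivial : ∃ σ ∈ W, ∃ x ∈ V₁, σ x ≠ x
  trivial : ∀ σ ∈ W, ∀ x ∈ V₂, σ x = x
  finrank_snd : Module.finrank ℝ V₂ = 1

/-- A fundamental domain for `W`: the closure of an open set, meeting every `W`-orbit in exactly one
point. -/
def IsReflectionFundamentalDomain (W : Subgroup (V ≃ₗᵢ[ℝ] V)) (F : Set V) : Prop :=
  (∃ U : Set V, IsOpen U ∧ F = closure U) ∧ ∀ x : V, ∃! y : V, y ∈ F ∧ ∃ σ ∈ W, σ x = y

/-- `H` is a facet hyperplane of the (full-dimensional) polyhedral cone `F`: `H` is a hyperplane,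
`F` lies in one of the two closed half-spaces bounded by `H`, and `F ∩ H` spans `H`. -/
def IsFacetHyperplane (F : Set V) (H : Submodule ℝ V) : Prop :=
  IsHyperplane H ∧
    (∃ φ : Module.Dual ℝ V, LinearMap.ker φ = H ∧ ∀ x ∈ F, 0 ≤ φ x) ∧
    Submodule.span ℝ (F ∩ H) = H

/-- A convex polyhedral cone: an intersection of finitely many closed linear half-spaces. -/
def IsPolyhedralCone (C : Set V) : Prop :=
  ∃ Φ : Finset (Module.Dual ℝ V), C = {x | ∀ φ ∈ Φ, 0 ≤ φ x}

/-- A symmetric cone: a convex polyhedral cone that is `W`-invariant. -/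
def IsSymmetricCone (W : Subgroup (V ≃ₗᵢ[ℝ] V)) (C : Set V) : Prop :=
  IsPolyhedralCone C ∧ ∀ σ ∈ W, σ '' C = C

/-- A monoconditional symmetric cone: one cut out by the `W`-orbit of a single linear form, whose
kernel contains neither `V₁` nor `V₂`. -/
def IsMonoconditional (W : Subgroup (V ≃ₗᵢ[ℝ] V)) (V₁ V₂ : Submodule ℝ V) (C : Set V) : Prop :=
  IsSymmetricCone W C ∧
    ∃ φ : Module.Dual ℝ V, ¬ V₁ ≤ LinearMap.ker φ ∧ ¬ V₂ ≤ LinearMap.ker φ ∧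
      C = {x | ∀ σ ∈ W, 0 ≤ φ (σ x)}

/-- `C_J`: the cone `C₊ = C ∩ F` without its points on the hyperplanes `H j`, `j ∈ J`. -/
def truncatedCone {ι : Type*} (C F : Set V) (H : ι → Submodule ℝ V) (J : Set ι) : Set V :=
  (C ∩ F) \ ⋃ j ∈ J, (H j : Set V)

end Reflection

/-! A point x of `C` is σ y for a unique y in `F`, and y lies in `C` by invariance. Several σ may
carry y to x; the pieces select exactly one. A shortest such σ qualifies: if y lay on `H j` for a
descent j, then σ s_j would also carry y to x and be shorter.

For uniqueness, fix p in `F` with trivial stabilizer. A wall separating p from σ⁻¹ p is a descent of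
σ, by the exchange condition (`exists_shorter_word`, `mem_rightDescentSet_of_inner_neg`). So if y
avoids the descent walls of σ, the direction σ⁻¹ p does not leave `F` through any wall containing y,
and y + ε σ⁻¹ p stays in `F` for small ε > 0. If σ y = τ y with y admissible for both, τ⁻¹σ carries
y + ε σ⁻¹ p to y + ε τ⁻¹ p. Both lie in `F`, hence agree, so σ⁻¹ p = τ⁻¹ p and σ = τ.

This rests on three facts: `F` is a closed Weyl chamber
(`IsReflectionFundamentalDomain.eq_chamber`), it is cut out by its facets (`mem_of_forall_facet`),
and the facet reflections generate `W` (`le_closure_reflections`). -/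

set_option linter.unusedSectionVars false

/-! ### Words in involutive generators. -/

section WordLength

variable {G ι : Type*} [Group G] {s : ι → G}

theorem mem_rightDescentSet {g : G} {j : ι} :
    j ∈ rightDescentSet s g ↔ wordLength s (g * s j) < wordLength s g := Iff.rfl

theorem wordLength_le (l : List ι) : wordLength s (l.map s).prod ≤ l.length :=
  Nat.sInf_le ⟨l, rfl, rfl⟩

theorem prod_map_reverse_of_involutive (hs : ∀ j, (s j)⁻¹ = s j) (l : List ι) :
    (l.reverse.map s).prod = (l.map s).prod⁻¹ := by
  rw [List.prod_inv_reverse, List.map_map, ← List.map_reverse]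
  congr 2
  funext j
  exact (hs j).symm

theorem exists_word_of_mem_closure (hs : ∀ j, (s j)⁻¹ = s j) {g : G}
    (hg : g ∈ Subgroup.closure (range s)) :
    ∃ l : List ι, l.length = wordLength s g ∧ (l.map s).prod = g := by
  refine Nat.sInf_mem (s := {k | ∃ l : List ι, l.length = k ∧ (l.map s).prod = g}) ?_
  suffices h : ∃ l : List ι, (l.map s).prod = g by
    obtain ⟨l, hl⟩ := h
    exact ⟨_, l, rfl, hl⟩
  induction hg using Subgroup.closure_induction with
  | mem x hx =>
    obtain ⟨j, rfl⟩ := hx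
    exact ⟨[j], by simp⟩
  | one => exact ⟨[], rfl⟩
  | mul x y _ _ hx hy =>
    obtain ⟨l, rfl⟩ := hx
    obtain ⟨m, rfl⟩ := hy
    exact ⟨l ++ m, by simp⟩
  | inv x _ hx =>
    obtain ⟨l, rfl⟩ := hx
    exact ⟨l.reverse, prod_map_reverse_of_involutive hs l⟩

end WordLength

/-! ### Hyperplanes and reflections. -/

section ReflectionGroups

variable {V : Type*} [NormedAddCommGroup V] [InnerProductSpace ℝ V] [FiniteDimensional ℝ V]

/-- The reflection at the hyperplane orthogonal to a unit vector. -/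
theorem reflection_orthogonal_unit_apply {K : Submodule ℝ V} {a : V} (ha : ‖a‖ = 1)
    (hK : K = (ℝ ∙ a)ᗮ) (x : V) : K.reflection x = x - (2 * inner ℝ a x) • a := by
  subst hK
  rw [Submodule.reflection_orthogonal_apply, Submodule.reflection_singleton_apply]
  simp only [ha]
  module

theorem inner_reflection_self {K : Submodule ℝ V} {a : V} (ha : ‖a‖ = 1)
    (hK : K = (ℝ ∙ a)ᗮ) (x : V) : inner ℝ a (K.reflection x) = - inner ℝ a x := by
  rw [reflection_orthogonal_unit_apply ha hK, inner_sub_right, inner_smul_right,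
    real_inner_self_eq_norm_sq, ha]
  ring

theorem isHyperplane_orthogonal_span_singleton {a : V} (ha : a ≠ 0) :
    IsHyperplane (ℝ ∙ a)ᗮ := by
  have h := (ℝ ∙ a).finrank_add_finrank_orthogonal
  rw [finrank_span_singleton ha] at h
  unfold IsHyperplane
  omega

theorem IsHyperplane.exists_unit_normal {K : Submodule ℝ V} (hK : IsHyperplane K) :
    ∃ a : V, ‖a‖ = 1 ∧ K = (ℝ ∙ a)ᗮ := by
  have h := K.finrank_add_finrank_orthogonal
  have h1 : Module.finrank ℝ Kᗮ = 1 := by unfold IsHyperplane at hK; omega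
  obtain ⟨v, hv0, hv⟩ := finrank_eq_one_iff'.1 h1
  have hv0' : (v : V) ≠ 0 := by simpa using hv0
  have hspan : Kᗮ = ℝ ∙ (v : V) := by
    apply le_antisymm
    · intro x hx
      obtain ⟨c, hc⟩ := hv ⟨x, hx⟩
      exact Submodule.mem_span_singleton.2 ⟨c, congrArg Subtype.val hc⟩
    · rw [Submodule.span_singleton_le_iff_mem]
      exact v.2
  refine ⟨‖(v : V)‖⁻¹ • (v : V), ?_, ?_⟩
  · rw [norm_smul, norm_inv, norm_norm, inv_mul_cancel₀ (norm_ne_zero_iff.2 hv0')]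
  · rw [Submodule.span_singleton_smul_eq (IsUnit.mk0 _ (inv_ne_zero (norm_ne_zero_iff.2 hv0'))),
      ← hspan, Submodule.orthogonal_orthogonal]

/-- Two hyperplanes, one of which contains the other, agree. -/
theorem IsHyperplane.eq_of_le {K L : Submodule ℝ V} (hK : IsHyperplane K) (hL : IsHyperplane L)
    (h : K ≤ L) : K = L :=
  Submodule.eq_of_le_of_finrank_eq h (by unfold IsHyperplane at *; omega)

theorem mem_orthogonal_span_singleton {a x : V} : x ∈ (ℝ ∙ a)ᗮ ↔ inner ℝ a x = 0 :=
  Submodule.mem_orthogonal_singleton_iff_inner_right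

theorem reflection_orthogonal_neg (a : V) :
    (ℝ ∙ (-a))ᗮ.reflection = (ℝ ∙ a)ᗮ.reflection := by
  ext x
  simp only [Submodule.reflection_orthogonal_apply, Submodule.reflection_singleton_apply,
    norm_neg, inner_neg_left]
  module

theorem linearIsometryEquiv_mul_apply (g h : V ≃ₗᵢ[ℝ] V) (x : V) : (g * h) x = g (h x) := rfl

theorem inner_isometry_left (g : V ≃ₗᵢ[ℝ] V) (a x : V) :
    inner ℝ (g a) x = inner ℝ a (g⁻¹ x) := by
  rw [← g.inner_map_map a (g⁻¹ x), ← linearIsometryEquiv_mul_apply, mul_inv_cancel]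
  rfl

theorem reflection_orthogonal_conj {a : V} (ha : ‖a‖ = 1) (g : V ≃ₗᵢ[ℝ] V) :
    (ℝ ∙ (g a))ᗮ.reflection = g * (ℝ ∙ a)ᗮ.reflection * g⁻¹ := by
  ext x
  rw [reflection_orthogonal_unit_apply (a := g a) (by rwa [g.norm_map]) rfl,
    linearIsometryEquiv_mul_apply, linearIsometryEquiv_mul_apply,
    reflection_orthogonal_unit_apply ha rfl, map_sub, map_smul, inner_isometry_left,
    ← linearIsometryEquiv_mul_apply g, mul_inv_cancel]
  rfl

/-- The fixed vectors of an isometry. -/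
def fixedSubspace (g : V ≃ₗᵢ[ℝ] V) : Submodule ℝ V :=
  (ContinuousLinearMap.id ℝ V - (g : V →L[ℝ] V)).ker

theorem mem_fixedSubspace {g : V ≃ₗᵢ[ℝ] V} {x : V} : x ∈ fixedSubspace g ↔ g x = x := by
  rw [fixedSubspace, LinearMap.mem_ker]
  change x - g x = 0 ↔ _
  rw [sub_eq_zero, eq_comm]

theorem fixedSubspace_ne_top {g : V ≃ₗᵢ[ℝ] V} (hg : g ≠ 1) : fixedSubspace g ≠ ⊤ := by
  intro h
  apply hg
  ext x
  exact mem_fixedSubspace.1 (h ▸ Submodule.mem_top)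

/-- An isometry whose fixed space has codimension at most one is a reflection. -/
theorem exists_eq_reflection {g : V ≃ₗᵢ[ℝ] V} (hg : g ≠ 1)
    (h : Module.finrank ℝ V ≤ Module.finrank ℝ (fixedSubspace g) + 1) :
    ∃ K : Submodule ℝ V, IsHyperplane K ∧ g = K.reflection := by
  have h1 := (fixedSubspace g).finrank_add_finrank_orthogonal
  obtain ⟨l, hl, hgl⟩ := g.reflections_generate_dim_aux (n := 1) (by
    change Module.finrank ℝ (fixedSubspace g)ᗮ ≤ 1
    omega)
  match l, hl with
  | [], _ => exact absurd hgl hg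
  | [v], _ =>
    simp only [List.map_cons, List.map_nil, List.prod_singleton] at hgl
    refine ⟨_, isHyperplane_orthogonal_span_singleton ?_, hgl⟩
    rintro rfl
    apply hg
    rw [hgl]
    ext x
    rw [Submodule.reflection_eq_self_iff _ |>.2 (by simp)]
    rfl
  | _ :: _ :: _, hl => simp at hl

/-! ### Generic points and fundamental domains. -/

/-- Finitely many proper subspaces do not cover a nonempty open set. -/
theorem IsOpen.exists_forall_notMem_submodule {ι : Type*} [Finite ι] {U : Set V} (hU : IsOpen U)
    (hne : U.Nonempty) (K : ι → Submodule ℝ V) (hK : ∀ i, K i ≠ ⊤) : ∃ x ∈ U, ∀ i, x ∉ K i := by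
  have : CompleteSpace V := FiniteDimensional.complete ℝ V
  have hd : Dense (⋂ i, ((K i : Set V)ᶜ)) := by
    apply dense_iInter_of_isOpen
    · intro i
      exact (K i).closed_of_finiteDimensional.isOpen_compl
    · intro i
      rw [← interior_eq_empty_iff_dense_compl]
      by_contra h
      exact hK i ((K i).eq_top_of_nonempty_interior' (nonempty_iff_ne_empty.2 h))
  obtain ⟨x, hx, hxU⟩ := hd.exists_mem_open hU hne |>.imp fun _ h => h
  exact ⟨x, hxU, fun i => mem_iInter.1 hx i⟩

/-- The fixed spaces of the nontrivial elements are finitely many proper subspaces, so they miss a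
point of the open set whose closure is `F`. -/
theorem exists_trivial_stabilizer {W : Subgroup (V ≃ₗᵢ[ℝ] V)} [Finite W] {F : Set V}
    (hF : IsReflectionFundamentalDomain W F) : ∃ p ∈ F, ∀ g ∈ W, g p = p → g = 1 := by
  obtain ⟨⟨U, hU, rfl⟩, h⟩ := hF
  have hne : U.Nonempty := by
    obtain ⟨y, ⟨hy, -⟩, -⟩ := h 0
    exact closure_nonempty_iff.1 ⟨y, hy⟩
  obtain ⟨p, hp, hpK⟩ := hU.exists_forall_notMem_submodule hne
    (fun g : {g : W // g ≠ 1} => fixedSubspace (g.1 : V ≃ₗᵢ[ℝ] V))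
    (fun g => fixedSubspace_ne_top fun h => g.2 (Subtype.ext h))
  refine ⟨p, subset_closure hp, fun g hg hgp => ?_⟩
  by_contra hne
  exact hpK ⟨⟨g, hg⟩, fun h => hne (congrArg Subtype.val h)⟩ (mem_fixedSubspace.2 hgp)

theorem IsReflectionFundamentalDomain.isClosed {W : Subgroup (V ≃ₗᵢ[ℝ] V)} {F : Set V}
    (hF : IsReflectionFundamentalDomain W F) : IsClosed F := by
  obtain ⟨⟨U, -, rfl⟩, -⟩ := hF
  exact isClosed_closure

theorem IsReflectionFundamentalDomain.exists_mem {W : Subgroup (V ≃ₗᵢ[ℝ] V)} {F : Set V}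
    (hF : IsReflectionFundamentalDomain W F) (x : V) : ∃ σ ∈ W, σ x ∈ F := by
  obtain ⟨y, ⟨hy, σ, hσ, rfl⟩, -⟩ := hF.2 x
  exact ⟨σ, hσ, hy⟩

theorem IsReflectionFundamentalDomain.apply_eq {W : Subgroup (V ≃ₗᵢ[ℝ] V)} {F : Set V}
    (hF : IsReflectionFundamentalDomain W F) {x : V} {σ : V ≃ₗᵢ[ℝ] V} (hσ : σ ∈ W) (hx : x ∈ F)
    (hσx : σ x ∈ F) : σ x = x :=
  (hF.2 x).unique ⟨hσx, σ, hσ, rfl⟩ ⟨hx, 1, W.one_mem, rfl⟩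

theorem tendsto_add_smul_nhdsGT (x v : V) :
    Filter.Tendsto (fun ε : ℝ => x + ε • v) (nhdsWithin 0 (Ioi 0)) (nhds x) := by
  have h : Filter.Tendsto (fun ε : ℝ => x + ε • v) (nhds 0) (nhds (x + (0 : ℝ) • v)) :=
    Continuous.tendsto (by fun_prop) 0
  rw [zero_smul, add_zero] at h
  exact h.mono_left nhdsWithin_le_nhds

/-- Finitely many homogeneous strict inequalities define an open set. -/
theorem isOpen_forall_inner_pos {A : Set V} (hA : A.Finite) :
    IsOpen {x : V | ∀ a ∈ A, 0 < inner ℝ a x} := by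
  simp only [ofPred_forall]
  exact hA.isOpen_biInter fun a _ => isOpen_lt continuous_const (by fun_prop)

/-- Among the images of `x` under a finite group, one that is nearest to `p` lies on the same side
as `p` of every reflection hyperplane of the group. -/
theorem exists_forall_inner_nonneg {G : Subgroup (V ≃ₗᵢ[ℝ] V)} [Finite G] {A : Set V} {p : V}
    (h1 : ∀ a ∈ A, ‖a‖ = 1) (hp : ∀ a ∈ A, 0 < inner ℝ a p)
    (hG : ∀ a ∈ A, (ℝ ∙ a)ᗮ.reflection ∈ G) (x : V) :
    ∃ w ∈ G, ∀ a ∈ A, 0 ≤ inner ℝ a (w x) := by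
  obtain ⟨w, hw⟩ := Finite.exists_max fun w : G => inner ℝ ((w : V ≃ₗᵢ[ℝ] V) x) p
  refine ⟨w, w.2, fun a ha => ?_⟩
  have h := hw (⟨_, hG a ha⟩ * w)
  simp only [Subgroup.coe_mul, LinearIsometryEquiv.coe_mul, Function.comp_apply] at h
  rw [reflection_orthogonal_unit_apply (h1 a ha) rfl, inner_sub_left, inner_smul_left] at h
  simp only [conj_trivial] at h
  have := hp a ha
  by_contra! hneg
  -- Were ⟨a, w x⟩ negative, reflecting would raise ⟨w x, p⟩ by -2⟨a, w x⟩⟨a, p⟩ > 0, against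
  -- maximality.
  nlinarith [mul_pos_of_neg_of_neg hneg (neg_lt_zero.2 this)]

/-! ### Positive roots and the Weyl chamber. -/

/-- The unit normals of the reflection hyperplanes of `W`, chosen on the side of `p`. -/
def positiveRoots (W : Subgroup (V ≃ₗᵢ[ℝ] V)) (p : V) : Set V :=
  {a | ‖a‖ = 1 ∧ 0 < inner ℝ a p ∧ (ℝ ∙ a)ᗮ.reflection ∈ W}

/-- A positive root is recovered from its reflection s: it is the unit vector in the direction p - s
p. -/
theorem positiveRoots_finite (W : Subgroup (V ≃ₗᵢ[ℝ] V)) [hW : Finite W] (p : V) :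
    (positiveRoots W p).Finite := by
  refine Set.Finite.of_injOn (f := fun a : V => (ℝ ∙ a)ᗮ.reflection) (t := (W : Set _))
    (fun a ha => ha.2.2) ?_ (Set.toFinite _)
  intro a ha b hb hab
  have h := DFunLike.congr_fun hab p
  simp only at h
  rw [reflection_orthogonal_unit_apply ha.1 rfl, reflection_orthogonal_unit_apply hb.1 rfl,
    sub_right_inj] at h
  have hn := congrArg norm h
  rw [norm_smul, norm_smul, ha.1, hb.1, Real.norm_of_nonneg (by linarith [ha.2.1]),
    Real.norm_of_nonneg (by linarith [hb.2.1]), mul_one, mul_one] at hn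
  rw [hn] at h
  exact smul_right_injective V (by linarith [hb.2.1] : (2 * inner ℝ b p) ≠ 0 ) h

theorem exists_mem_positiveRoots {W : Subgroup (V ≃ₗᵢ[ℝ] V)} {p : V}
    (hp : ∀ g ∈ W, g p = p → g = 1) {K : Submodule ℝ V} (hK : IsHyperplane K)
    (hKW : K.reflection ∈ W) : ∃ a ∈ positiveRoots W p, K = (ℝ ∙ a)ᗮ := by
  obtain ⟨a, ha, hKa⟩ := hK.exists_unit_normal
  have hne : inner ℝ a p ≠ 0 := by
    intro h
    have h1 := hp _ hKW (by rw [reflection_orthogonal_unit_apply ha hKa, h]; simp)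
    have h2 := inner_reflection_self ha hKa a
    rw [h1, LinearIsometryEquiv.coe_one, id, real_inner_self_eq_norm_sq, ha] at h2
    norm_num at h2
  subst hKa
  rcases lt_or_gt_of_ne hne with h | h
  · refine ⟨-a, ⟨by simpa using ha, by simpa using h, ?_⟩, ?_⟩
    · rwa [reflection_orthogonal_neg]
    · ext x
      simp only [mem_orthogonal_span_singleton, inner_neg_left, neg_eq_zero]
  · exact ⟨a, ⟨ha, h, hKW⟩, rfl⟩

/-- A connected set of points with trivial stabilizer which meets a fundamental domain lies in it. -/
theorem IsReflectionFundamentalDomain.subset_of_isPreconnected {W : Subgroup (V ≃ₗᵢ[ℝ] V)}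
    [Finite W] {F : Set V} (hF : IsReflectionFundamentalDomain W F) {S : Set V}
    (hS : IsPreconnected S) (hreg : ∀ x ∈ S, ∀ g ∈ W, g x = x → g = 1) {p : V} (hpS : p ∈ S)
    (hpF : p ∈ F) : S ⊆ F := by
  -- `F` and the union `T` of its other translates are closed and cover `V`; a point in both is
  -- fixed by some σ ≠ 1.
  let T : Set V := ⋃ σ : {σ : W // σ ≠ 1}, (σ.1 : V ≃ₗᵢ[ℝ] V) '' F
  have hT : IsClosed T := isClosed_iUnion_of_finite fun σ =>
    (σ.1 : V ≃ₗᵢ[ℝ] V).toHomeomorph.isClosedMap _ hF.isClosed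
  have hST : S ⊆ F ∪ T := by
    intro x _
    obtain ⟨σ, hσ, hσx⟩ := hF.exists_mem x
    by_cases h1 : σ = 1
    · left
      simpa [h1] using hσx
    · right
      refine mem_iUnion.2 ⟨⟨⟨σ, hσ⟩⁻¹, fun h => h1 ?_⟩, σ x, hσx, ?_⟩
      · simpa using congrArg Subtype.val h
      · exact σ.symm_apply_apply x
  intro x hx
  by_contra hxF
  have hxT : x ∈ T := (hST hx).resolve_left hxF
  obtain ⟨y, hyS, hyF, hyT⟩ := isPreconnected_closed_iff.1 hS F T hF.isClosed hT hST
    ⟨p, hpS, hpF⟩ ⟨x, hx, hxT⟩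
  obtain ⟨⟨σ, hσ⟩, z, hz, rfl⟩ := mem_iUnion.1 hyT
  have h := hF.apply_eq σ.2 hz hyF
  simp only at hyS
  rw [h] at hyS
  exact hσ (Subtype.ext (hreg z hyS _ σ.2 h))

/-- A fundamental domain of a finite reflection group is a closed Weyl chamber. -/
theorem IsReflectionFundamentalDomain.eq_chamber {W : Subgroup (V ≃ₗᵢ[ℝ] V)}
    [Finite W] {F : Set V} (hF : IsReflectionFundamentalDomain W F) {p : V} (hpF : p ∈ F)
    (hp : ∀ g ∈ W, g p = p → g = 1) : F = {x | ∀ a ∈ positiveRoots W p, 0 ≤ inner ℝ a x} := by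
  have hfin := positiveRoots_finite W p
  have hopen := isOpen_forall_inner_pos hfin
  have hD : {x : V | ∀ a ∈ positiveRoots W p, 0 < inner ℝ a x} ⊆ F := by
    intro x hx
    by_contra hxF
    have hU := hopen.inter hF.isClosed.isOpen_compl
    -- Move the bad point to a generic y, so that the segment from p to y avoids every fixed space
    -- of codimension at least two. Mirrors are avoided because their roots are positive at both
    -- ends.
    obtain ⟨y, ⟨hy, hyF⟩, hyK⟩ := hU.exists_forall_notMem_submodule ⟨x, hx, hxF⟩
      (fun g : {g : W // fixedSubspace (g : V ≃ₗᵢ[ℝ] V) ⊔ (ℝ ∙ p) ≠ ⊤} =>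
        fixedSubspace (g.1 : V ≃ₗᵢ[ℝ] V) ⊔ (ℝ ∙ p)) (fun g => g.2)
    refine hyF (hF.subset_of_isPreconnected (convex_segment p y).isPreconnected ?_
      (left_mem_segment ℝ p y) hpF (right_mem_segment ℝ p y))
    rintro z ⟨s, t, hs, ht, hst, rfl⟩ g hg hgz
    by_contra hg1
    by_cases htop : fixedSubspace g ⊔ (ℝ ∙ p) = ⊤
    · obtain ⟨K, hK, rfl⟩ := exists_eq_reflection hg1 (by
        have h1 := Submodule.finrank_add_le_finrank_add_finrank (fixedSubspace g) (ℝ ∙ p)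
        rw [htop, finrank_top] at h1
        have h2 := finrank_span_le_card (R := ℝ) ({p} : Set V)
        simp only [toFinset_singleton, Finset.card_singleton] at h2
        omega)
      obtain ⟨a, ha, rfl⟩ := exists_mem_positiveRoots hp hK hg
      rw [Submodule.reflection_eq_self_iff, mem_orthogonal_span_singleton, inner_add_right,
        inner_smul_right, inner_smul_right] at hgz
      have hap := ha.2.1
      have hay := hy a ha
      rcases hs.eq_or_lt with rfl | hs
      · obtain rfl : t = 1 := by linarith
        linarith
      · nlinarith [mul_pos hs hap, mul_nonneg ht hay.le]
    · rcases ht.eq_or_lt with rfl | ht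
      · obtain rfl : s = 1 := by linarith
        exact hg1 (hp g hg (by simpa using hgz))
      · refine hyK ⟨⟨g, hg⟩, htop⟩ ?_
        have : y = t⁻¹ • (s • p + t • y) + (-(t⁻¹ * s)) • p := by
          rw [smul_add, smul_smul, smul_smul, inv_mul_cancel₀ ht.ne']
          module
        rw [this]
        exact Submodule.add_mem_sup (Submodule.smul_mem _ _ (mem_fixedSubspace.2 hgz))
          (Submodule.smul_mem _ _ (Submodule.mem_span_singleton_self p))
  have hcl : {x | ∀ a ∈ positiveRoots W p, 0 ≤ inner ℝ a x} ⊆ F := by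
    intro x hx
    have hlim := tendsto_add_smul_nhdsGT x p
    refine hF.isClosed.mem_of_tendsto hlim ?_
    filter_upwards [self_mem_nhdsWithin] with ε hε
    refine hD fun a ha => ?_
    rw [inner_add_right, inner_smul_right]
    exact add_pos_of_nonneg_of_pos (hx a ha) (mul_pos hε ha.2.1)
  refine Subset.antisymm (fun x hx => ?_) hcl
  obtain ⟨w, hw, hwx⟩ := exists_forall_inner_nonneg (G := W) (A := positiveRoots W p) (p := p)
    (fun a ha => ha.1) (fun a ha => ha.2.1) (fun a ha => ha.2.2) x
  rw [← hF.apply_eq hw hx (hcl hwx)]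
  exact hwx

/-! ### Facets of a polyhedral cone. -/

/-- A facet hyperplane of the chamber is the orthogonal complement of a positive root. -/
theorem IsFacetHyperplane.exists_mem {A : Set V} (hA : A.Finite) {F : Set V} {H : Submodule ℝ V}
    {p : V} (hAp : ∀ a ∈ A, 0 < inner ℝ a p)
    (hF : F = {x | ∀ a ∈ A, 0 ≤ inner ℝ a x}) (hH : IsFacetHyperplane F H) :
    ∃ a ∈ A, H = (ℝ ∙ a)ᗮ := by
  obtain ⟨hHyp, ⟨φ, hφH, hφ⟩, hspan⟩ := hH
  by_contra! hcon
  have hz : ∀ a ∈ A, ∃ z ∈ F ∩ H, 0 < inner ℝ a z := by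
    intro a ha
    by_contra! h
    refine hcon a ha (hHyp.eq_of_le (isHyperplane_orthogonal_span_singleton ?_) ?_)
    · rintro rfl
      simpa using hAp _ ha
    · rw [← hspan, Submodule.span_le]
      intro x hx
      refine mem_orthogonal_span_singleton.2 (le_antisymm (h x hx) ?_)
      have := hx.1
      rw [hF] at this
      exact this a ha
  choose! z hzF hz using hz
  have hmem : ∀ b ∈ A, ∀ a ∈ A, 0 ≤ inner ℝ a (z b) := by
    intro b hb a ha
    have := (hzF b hb).1
    rw [hF] at this
    exact this a ha
  -- If `H` is no root hyperplane, this sum is an interior point of `F` on `H`, impossible for a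
  -- supporting hyperplane.
  set y := ∑ b ∈ hA.toFinset, z b with hy
  have hyA : ∀ a ∈ A, 0 < inner ℝ a y := by
    intro a ha
    rw [hy, inner_sum]
    exact Finset.sum_pos' (fun b hb => hmem b (hA.mem_toFinset.1 hb) a ha)
      ⟨a, hA.mem_toFinset.2 ha, hz a ha⟩
  have hyH : φ y = 0 := by
    rw [← LinearMap.mem_ker, hφH]
    exact Submodule.sum_mem _ fun b hb => (hzF b (hA.mem_toFinset.1 hb)).2
  have hopen := isOpen_forall_inner_pos hA
  have hker : H = ⊤ := by
    rw [← hφH, LinearMap.ker_eq_top]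
    ext v
    have hev : ∀ v : V, 0 ≤ φ v := by
      intro v
      have hlim := tendsto_add_smul_nhdsGT y v
      obtain ⟨ε, hε, hε0⟩ := ((hlim.eventually (hopen.mem_nhds hyA)).and
        self_mem_nhdsWithin).exists
      have := hφ (y + ε • v) (by rw [hF]; exact fun a ha => (hε a ha).le)
      rw [map_add, map_smul, hyH, zero_add, smul_eq_mul] at this
      exact nonneg_of_mul_nonneg_right this hε0
    have h1 := hev v
    have h2 := hev (-v)
    rw [map_neg] at h2
    simp only [LinearMap.zero_apply]
    linarith
  rw [hker] at hHyp
  simp [IsHyperplane] at hHyp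

/-- A cone cut out by finitely many half-spaces with a common interior point is cut out by
those that belong to facets. -/
theorem mem_of_forall_facet {A : Set V} (hA : A.Finite) {F : Set V}
    {p : V} (hAp : ∀ a ∈ A, 0 < inner ℝ a p) (hF : F = {x | ∀ a ∈ A, 0 ≤ inner ℝ a x}) {x : V}
    (hx : ∀ a ∈ A, IsFacetHyperplane F (ℝ ∙ a)ᗮ → 0 ≤ inner ℝ a x) : x ∈ F := by
  classical
  -- In a minimal system of inequalities each one defines a facet.
  obtain ⟨S, ⟨hSA, hSF⟩, hmin⟩ := wellFounded_lt.has_min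
    {S : Finset V | (S : Set V) ⊆ A ∧ F = {x | ∀ a ∈ S, 0 ≤ inner ℝ a x}}
    ⟨hA.toFinset, by simp, by simpa using hF⟩
  rw [hSF]
  intro a ha
  refine hx a (hSA ha) ⟨isHyperplane_orthogonal_span_singleton ?_, ⟨innerₛₗ ℝ a, ?_, ?_⟩, ?_⟩
  · rintro rfl
    simpa using hAp _ (hSA ha)
  · ext v
    rw [mem_orthogonal_span_singleton]
    rfl
  · intro v hv
    rw [hSF] at hv
    exact hv a ha
  · have hne := hmin (S.erase a)
    have hlt : S.erase a < S := Finset.erase_ssubset ha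
    have hnot : ¬ ({x | ∀ b ∈ S.erase a, 0 ≤ inner ℝ b x} ⊆ F) := fun h =>
      hne ⟨fun b hb => hSA (Finset.mem_of_mem_erase hb), Subset.antisymm (by
        rw [hSF]; exact fun v hv b hb => hv b (Finset.mem_of_mem_erase hb)) h⟩ hlt
    obtain ⟨y, hy, hyF⟩ := not_subset.1 hnot
    have hya : inner ℝ a y < 0 := by
      by_contra! h
      apply hyF
      rw [hSF]
      intro b hb
      by_cases hba : b = a
      · rwa [hba]
      · exact hy b (Finset.mem_erase.2 ⟨hba, hb⟩)
    have hpa := hAp a (hSA ha)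
    -- Up to a positive factor, z is where the segment from p to y crosses the hyperplane of a. A
    -- neighbourhood of z in that hyperplane lies in `F` and spans it.
    set z := (inner ℝ a p) • y - (inner ℝ a y) • p with hz
    have hza : inner ℝ a z = 0 := by
      rw [hz, inner_sub_right, inner_smul_right, inner_smul_right]
      ring
    have hzb : ∀ b ∈ S.erase a, 0 < inner ℝ b z := by
      intro b hb
      rw [hz, inner_sub_right, inner_smul_right, inner_smul_right]
      nlinarith [mul_nonneg hpa.le (hy b hb),
        mul_pos (neg_pos.2 hya) (hAp b (hSA (Finset.mem_of_mem_erase hb)))]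
    have hopen := isOpen_forall_inner_pos (S.erase a).finite_toSet
    have hmemF : ∀ v : V, inner ℝ a v = 0 → (∀ b ∈ S.erase a, 0 < inner ℝ b v) →
        v ∈ F ∩ ((ℝ ∙ a)ᗮ : Submodule ℝ V) := by
      intro v hva hvb
      refine ⟨?_, mem_orthogonal_span_singleton.2 hva⟩
      rw [hSF]
      intro b hb
      by_cases hba : b = a
      · rw [hba, hva]
      · exact (hvb b (Finset.mem_erase.2 ⟨hba, hb⟩)).le
    apply le_antisymm
    · rw [Submodule.span_le]
      exact inter_subset_right
    · intro v hv
      have hlim := tendsto_add_smul_nhdsGT z v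
      obtain ⟨ε, hε, hε0⟩ := ((hlim.eventually (hopen.mem_nhds hzb)).and
        self_mem_nhdsWithin).exists
      have h1 := Submodule.subset_span (R := ℝ) (hmemF z hza hzb)
      have h2 := Submodule.subset_span (R := ℝ) (hmemF (z + ε • v) (by
        rw [inner_add_right, inner_smul_right, hza, mem_orthogonal_span_singleton.1 hv]
        simp) hε)
      have h3 := Submodule.smul_mem _ ε⁻¹ (Submodule.sub_mem _ h2 h1)
      rwa [add_sub_cancel_left, smul_smul, inv_mul_cancel₀ (ne_of_gt hε0), one_smul] at h3

/-! ### Exchange condition, descents and generation. -/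

/-- A root hyperplane that separates the chamber of `p` from its mirror image at a facet
hyperplane is that facet hyperplane. -/
theorem IsFacetHyperplane.eq_of_separates {W : Subgroup (V ≃ₗᵢ[ℝ] V)} {p : V}
    {F : Set V} (hF : F = {x | ∀ a ∈ positiveRoots W p, 0 ≤ inner ℝ a x}) {H : Submodule ℝ V}
    (hH : IsFacetHyperplane F H) (hHW : H.reflection ∈ W) {a : V} (ha : a ∈ positiveRoots W p)
    (hsep : inner ℝ (H.reflection a) p < 0) : H = (ℝ ∙ a)ᗮ := by
  refine hH.1.eq_of_le (isHyperplane_orthogonal_span_singleton ?_) ?_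
  · rintro rfl
    simpa using ha.1
  have hb : -(H.reflection a) ∈ positiveRoots W p := by
    refine ⟨by rw [norm_neg, LinearIsometryEquiv.norm_map, ha.1], by simpa using hsep, ?_⟩
    rw [reflection_orthogonal_neg, reflection_orthogonal_conj ha.1]
    exact W.mul_mem (W.mul_mem hHW ha.2.2) (W.inv_mem hHW)
  -- On `F ∩ H`, which the reflection fixes, the positive roots a and -(s a) take opposite values,
  -- so both vanish.
  rw [← hH.2.2, Submodule.span_le]
  rintro x ⟨hxF, hxH⟩
  rw [hF] at hxF
  have h1 := hxF a ha
  have h2 := hxF _ hb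
  rw [inner_neg_left, inner_isometry_left, Submodule.reflection_inv,
    Submodule.reflection_mem_subspace_eq_self hxH] at h2
  exact mem_orthogonal_span_singleton.2 (by linarith)

/-- The exchange condition: a reflection at a hyperplane that separates `p` from its image under
a word in the reflections at facet hyperplanes shortens that word. -/
theorem exists_shorter_word {W : Subgroup (V ≃ₗᵢ[ℝ] V)} {p : V}
    (hp : ∀ g ∈ W, g p = p → g = 1) {F : Set V}
    (hF : F = {x | ∀ a ∈ positiveRoots W p, 0 ≤ inner ℝ a x}) {ι : Type*} {H : ι → Submodule ℝ V}
    (hH : ∀ j, IsFacetHyperplane F (H j)) (hHW : ∀ j, (H j).reflection ∈ W) (l : List ι) {a : V}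
    (ha : a ∈ positiveRoots W p) (hsep : inner ℝ a ((l.map fun j => (H j).reflection).prod p) < 0) :
    ∃ m : List ι, m.length < l.length ∧
      (m.map fun j => (H j).reflection).prod =
        (ℝ ∙ a)ᗮ.reflection * (l.map fun j => (H j).reflection).prod := by
  induction l generalizing a with
  | nil =>
    have := ha.2.1
    simp only [List.map_nil, List.prod_nil, LinearIsometryEquiv.coe_one, id] at hsep
    linarith
  | cons i l ih =>
    rw [List.map_cons, List.prod_cons] at hsep ⊢
    set g := (l.map fun j => (H j).reflection).prod
    have hbW : (ℝ ∙ ((H i).reflection a))ᗮ.reflection =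
        (H i).reflection * (ℝ ∙ a)ᗮ.reflection * (H i).reflection := by
      rw [reflection_orthogonal_conj ha.1, Submodule.reflection_inv]
    have hbmem : (ℝ ∙ ((H i).reflection a))ᗮ.reflection ∈ W := by
      rw [hbW]
      exact W.mul_mem (W.mul_mem (hHW i) ha.2.2) (hHW i)
    have hbn : ‖(H i).reflection a‖ = 1 := by rw [LinearIsometryEquiv.norm_map, ha.1]
    -- Conjugating by the first letter replaces a by its mirror image. If that is negative at p, a
    -- is the root of this letter, which cancels; zero is excluded by the choice of p; otherwise
    -- recurse on the tail.
    rcases lt_trichotomy (inner ℝ ((H i).reflection a) p) 0 with h | h | h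
    · have hHa := (hH i).eq_of_separates hF (hHW i) ha h
      have hra : (ℝ ∙ a)ᗮ.reflection = (H i).reflection := by
        ext x
        rw [reflection_orthogonal_unit_apply ha.1 hHa, reflection_orthogonal_unit_apply ha.1 rfl]
      refine ⟨l, by simp, ?_⟩
      rw [hra, ← mul_assoc, Submodule.reflection_mul_reflection, one_mul]
    · exfalso
      have h1 := hp _ hbmem (by rw [reflection_orthogonal_unit_apply hbn rfl, h]; simp)
      have h2 := inner_reflection_self hbn rfl ((H i).reflection a)
      rw [h1, LinearIsometryEquiv.coe_one, id, real_inner_self_eq_norm_sq, hbn] at h2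
      norm_num at h2
    · obtain ⟨m, hm, hmp⟩ := ih ⟨hbn, h, hbmem⟩ (by
        rw [inner_isometry_left, Submodule.reflection_inv]
        exact hsep)
      refine ⟨i :: m, by simpa using hm, ?_⟩
      rw [List.map_cons, List.prod_cons, hmp, hbW]
      simp only [← mul_assoc, Submodule.reflection_mul_reflection, one_mul]

/-- The descents of `σ` include the facet hyperplanes that separate `p` from `σ⁻¹ p`. -/
theorem mem_rightDescentSet_of_inner_neg {W : Subgroup (V ≃ₗᵢ[ℝ] V)} {p : V}
    (hp : ∀ g ∈ W, g p = p → g = 1) {F : Set V}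
    (hF : F = {x | ∀ a ∈ positiveRoots W p, 0 ≤ inner ℝ a x}) {ι : Type*} {H : ι → Submodule ℝ V}
    (hH : ∀ j, IsFacetHyperplane F (H j)) (hHW : ∀ j, (H j).reflection ∈ W)
    {σ : V ≃ₗᵢ[ℝ] V} (hσ : σ ∈ Subgroup.closure (range fun j => (H j).reflection)) {j : ι} {a : V}
    (ha : a ∈ positiveRoots W p) (hHa : H j = (ℝ ∙ a)ᗮ) (hneg : inner ℝ a (σ⁻¹ p) < 0) :
    j ∈ rightDescentSet (fun j => (H j).reflection) σ := by
  have hs : ∀ j, ((H j).reflection)⁻¹ = (H j).reflection := fun _ => Submodule.reflection_inv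
  obtain ⟨l, hl, hlp⟩ := exists_word_of_mem_closure hs hσ
  have hrev := prod_map_reverse_of_involutive hs l
  rw [hlp] at hrev
  -- The reversed word spells σ⁻¹, so shortening on its left shortens σ on the right.
  obtain ⟨m, hm, hmp⟩ := exists_shorter_word hp hF hH hHW l.reverse ha (by rwa [hrev])
  have hra : (ℝ ∙ a)ᗮ.reflection = (H j).reflection := by
    ext x
    rw [reflection_orthogonal_unit_apply ha.1 hHa, reflection_orthogonal_unit_apply ha.1 rfl]
  rw [hrev, hra] at hmp
  have hmr := prod_map_reverse_of_involutive hs m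
  rw [hmp, mul_inv_rev, inv_inv, hs] at hmr
  have hle := wordLength_le (s := fun j => (H j).reflection) m.reverse
  rw [hmr] at hle
  rw [List.length_reverse] at hm hle
  rw [mem_rightDescentSet]
  omega

/-- The reflections at the walls of a chamber generate the group. -/
theorem le_closure_reflections {W : Subgroup (V ≃ₗᵢ[ℝ] V)} [Finite W] {F : Set V}
    (hFd : IsReflectionFundamentalDomain W F) {p : V} (hpF : p ∈ F)
    (hp : ∀ g ∈ W, g p = p → g = 1) {ι : Type*} {H : ι → Submodule ℝ V} {a : ι → V}
    (ha : ∀ j, a j ∈ positiveRoots W p) (hHa : ∀ j, H j = (ℝ ∙ (a j))ᗮ)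
    (hF : F = {x | ∀ j, 0 ≤ inner ℝ (a j) x}) :
    W ≤ Subgroup.closure (range fun j => (H j).reflection) := by
  obtain rfl : H = fun j => (ℝ ∙ (a j))ᗮ := funext hHa
  set G := Subgroup.closure (range fun j => (ℝ ∙ (a j))ᗮ.reflection) with hG
  have hGW : G ≤ W := by
    rw [hG, Subgroup.closure_le]
    rintro _ ⟨j, rfl⟩
    exact (ha j).2.2
  have : Finite G := Finite.of_injective _ (Subgroup.inclusion_injective hGW)
  intro σ hσ
  -- Some w generated by the walls brings σ p back into `F`; then w σ fixes p, so σ = w⁻¹.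
  obtain ⟨w, hw, hwx⟩ := exists_forall_inner_nonneg (G := G) (A := range a) (p := p)
    (by rintro _ ⟨j, rfl⟩; exact (ha j).1) (by rintro _ ⟨j, rfl⟩; exact (ha j).2.1)
    (by rintro _ ⟨j, rfl⟩; exact Subgroup.subset_closure ⟨j, rfl⟩) (σ p)
  have hmem : (w * σ) p ∈ F := by
    rw [hF]
    exact fun j => hwx _ ⟨j, rfl⟩
  have hwσ := W.mul_mem (hGW hw) hσ
  have h1 := hp _ hwσ (hFd.apply_eq hwσ hpF hmem)
  rw [eq_inv_of_mul_eq_one_right h1]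
  exact G.inv_mem hw

end ReflectionGroups

/-! ### The decomposition of the cone. -/

theorem mainTheorem3 {V : Type*} [NormedAddCommGroup V] [InnerProductSpace ℝ V]
    [FiniteDimensional ℝ V] (W : Subgroup (V ≃ₗᵢ[ℝ] V)) (V₁ V₂ : Submodule ℝ V)
    (hW : IsAlmostIrreducible W V₁ V₂)
    (C : Set V) (hC : IsMonoconditional W V₁ V₂ C)
    (F : Set V) (hF : IsReflectionFundamentalDomain W F)
    (r : ℕ) (H : Fin r → Submodule ℝ V) (hH : Function.Injective H)
    (hHF : Set.range H = {K | IsFacetHyperplane F K}) :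
    (C = ⋃ σ : W, (σ : V ≃ₗᵢ[ℝ] V) ''
        truncatedCone C F H (rightDescentSet (fun j => (H j).reflection) (σ : V ≃ₗᵢ[ℝ] V))) ∧
      Pairwise fun σ τ : W => Disjoint
        ((σ : V ≃ₗᵢ[ℝ] V) ''
          truncatedCone C F H (rightDescentSet (fun j => (H j).reflection) (σ : V ≃ₗᵢ[ℝ] V)))
        ((τ : V ≃ₗᵢ[ℝ] V) ''
          truncatedCone C F H (rightDescentSet (fun j => (H j).reflection) (τ : V ≃ₗᵢ[ℝ] V))) := by
  have : Finite W := hW.reflectionGroup.1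
  have hCW : ∀ σ ∈ W, ∀ x ∈ C, σ x ∈ C := fun σ hσ x hx => by
    rw [← hC.1.2 σ hσ]
    exact mem_image_of_mem σ hx
  obtain ⟨p, hpF, hp⟩ := exists_trivial_stabilizer hF
  have hFΦ := hF.eq_chamber hpF hp
  have hfin := positiveRoots_finite W p
  have hfacet : ∀ j, IsFacetHyperplane F (H j) := fun j => by
    have : H j ∈ range H := ⟨j, rfl⟩
    rwa [hHF] at this
  choose a ha hHa using fun j => (hfacet j).exists_mem hfin (fun a ha => ha.2.1) hFΦ
  have hHW : ∀ j, (H j).reflection ∈ W := fun j => by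
    obtain rfl : H = fun j => (ℝ ∙ (a j))ᗮ := funext hHa
    exact (ha j).2.2
  have hFa : F = {x | ∀ j, 0 ≤ inner ℝ (a j) x} := by
    refine Subset.antisymm (fun x hx j => ?_) fun x hx => ?_
    · rw [hFΦ] at hx
      exact hx _ (ha j)
    · refine mem_of_forall_facet hfin (fun a ha => ha.2.1) hFΦ fun b hb hbF => ?_
      obtain ⟨j, hj⟩ : (ℝ ∙ b)ᗮ ∈ range H := by rw [hHF]; exact hbF
      have hker : ∀ v : V, inner ℝ b v = 0 ↔ inner ℝ (a j) v = 0 := fun v => by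
        rw [← mem_orthogonal_span_singleton, ← mem_orthogonal_span_singleton, ← hj, hHa]
      -- This vector lies in the common hyperplane of b and `a j`, so ⟨a j, p⟩⟨b, x⟩ = ⟨a j, x⟩⟨b,
      -- p⟩ and the two roots have the same sign at x.
      have hz := (hker (inner ℝ (a j) p • x - inner ℝ (a j) x • p)).2 (by
        rw [inner_sub_right, inner_smul_right, inner_smul_right]
        ring)
      rw [inner_sub_right, inner_smul_right, inner_smul_right] at hz
      have h1 := mul_nonneg (hx j) hb.2.1.le
      exact nonneg_of_mul_nonneg_right (by linarith) (ha j).2.1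
  have hgen := le_closure_reflections hF hpF hp ha hHa hFa
  have hdesc : ∀ σ ∈ W, ∀ y : V,
      y ∉ ⋃ j ∈ rightDescentSet (fun j => (H j).reflection) σ, (H j : Set V) →
      ∀ j, inner ℝ (a j) y = 0 → 0 ≤ inner ℝ (a j) (σ⁻¹ p) := by
    intro σ hσ y hy j hj
    by_contra! hneg
    refine hy (mem_biUnion
      (mem_rightDescentSet_of_inner_neg hp hFΦ hfacet hHW (hgen hσ) (ha j) (hHa j) hneg) ?_)
    rw [SetLike.mem_coe, hHa]
    exact mem_orthogonal_span_singleton.2 hj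
  have hnear : ∀ σ ∈ W, ∀ y ∈ F,
      y ∉ ⋃ j ∈ rightDescentSet (fun j => (H j).reflection) σ, (H j : Set V) →
      ∀ᶠ ε : ℝ in nhdsWithin 0 (Ioi 0), y + ε • σ⁻¹ p ∈ F := by
    intro σ hσ y hyF hy
    rw [hFa] at hyF ⊢
    rw [show (∀ᶠ ε : ℝ in nhdsWithin 0 (Ioi 0),
        y + ε • σ⁻¹ p ∈ {x | ∀ j, 0 ≤ inner ℝ (a j) x}) ↔ ∀ j, ∀ᶠ ε : ℝ in nhdsWithin 0 (Ioi 0),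
        0 ≤ inner ℝ (a j) (y + ε • σ⁻¹ p) from Filter.eventually_all]
    intro j
    -- Walls through y are not descents, so `hdesc` applies; at the other walls positivity persists
    -- for small ε.
    rcases (hyF j).eq_or_lt with h | h
    · filter_upwards [self_mem_nhdsWithin] with ε hε
      rw [inner_add_right, inner_smul_right, ← h, zero_add]
      exact mul_nonneg (le_of_lt hε) (hdesc σ hσ y hy j h.symm)
    · have hopen : IsOpen {x : V | 0 < inner ℝ (a j) x} :=
        isOpen_lt continuous_const (by fun_prop)
      exact ((tendsto_add_smul_nhdsGT y (σ⁻¹ p)).eventually (hopen.mem_nhds h)).mono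
        fun _ h => le_of_lt h
  refine ⟨Subset.antisymm (fun x hx => ?_) (iUnion_subset fun σ => ?_), ?_⟩
  · obtain ⟨τ, hτ, hτx⟩ := hF.exists_mem x
    set y := τ x
    have : Nonempty {σ : W // (σ : V ≃ₗᵢ[ℝ] V) y = x} :=
      ⟨⟨⟨τ, hτ⟩⁻¹, τ.symm_apply_apply x⟩⟩
    obtain ⟨⟨σ, hσ⟩, hmin⟩ := Finite.exists_min fun σ : {σ : W // (σ : V ≃ₗᵢ[ℝ] V) y = x} =>
      wordLength (fun j => (H j).reflection) (σ.1 : V ≃ₗᵢ[ℝ] V)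
    have hmin' : ∀ ρ ∈ W, ρ y = x → wordLength (fun j => (H j).reflection) (σ : V ≃ₗᵢ[ℝ] V) ≤
        wordLength (fun j => (H j).reflection) ρ := fun ρ hρ h => hmin ⟨⟨ρ, hρ⟩, h⟩
    refine mem_iUnion.2 ⟨σ, y, ⟨⟨hCW τ hτ x hx, hτx⟩, ?_⟩, hσ⟩
    intro hy
    obtain ⟨j, hj, hyj⟩ := mem_iUnion₂.1 hy
    have hlt := mem_rightDescentSet.1 hj
    refine (hmin' _ (W.mul_mem σ.2 (hHW j)) ?_).not_gt hlt
    rw [linearIsometryEquiv_mul_apply, Submodule.reflection_mem_subspace_eq_self hyj, hσ]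
  · rintro _ ⟨y, hy, rfl⟩
    exact hCW σ σ.2 y hy.1.1
  · intro σ τ hne
    rw [Set.disjoint_left]
    rintro _ ⟨y, ⟨⟨-, hyF⟩, hyσ⟩, rfl⟩ ⟨z, ⟨⟨-, hzF⟩, hzτ⟩, hzy⟩
    have hg : (τ : V ≃ₗᵢ[ℝ] V)⁻¹ * σ ∈ W := W.mul_mem (W.inv_mem τ.2) σ.2
    have hgy : ((τ : V ≃ₗᵢ[ℝ] V)⁻¹ * σ) y = z := by
      rw [linearIsometryEquiv_mul_apply, ← hzy]
      exact (τ : V ≃ₗᵢ[ℝ] V).symm_apply_apply z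
    obtain rfl : z = y := by
      rw [← hgy]
      exact hF.apply_eq hg hyF (by rwa [hgy])
    obtain ⟨ε, ⟨h1, h2⟩, hε⟩ := (((hnear σ σ.2 z hyF hyσ).and (hnear τ τ.2 z hzF hzτ)).and
      self_mem_nhdsWithin).exists
    have hmap : ((τ : V ≃ₗᵢ[ℝ] V)⁻¹ * σ) (z + ε • (σ : V ≃ₗᵢ[ℝ] V)⁻¹ p) =
        z + ε • (τ : V ≃ₗᵢ[ℝ] V)⁻¹ p := by
      rw [map_add, map_smul, hgy, ← linearIsometryEquiv_mul_apply, mul_inv_cancel_right]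
    have heq := hF.apply_eq hg h1 (by rwa [hmap])
    rw [hmap, add_right_inj] at heq
    have heq' := smul_right_injective V (ne_of_gt hε) heq
    apply hne
    have hfix := hp (σ * (τ : V ≃ₗᵢ[ℝ] V)⁻¹) (W.mul_mem σ.2 (W.inv_mem τ.2)) (by
      rw [linearIsometryEquiv_mul_apply, heq', ← linearIsometryEquiv_mul_apply, mul_inv_cancel]
      rfl)
    exact Subtype.ext (mul_inv_eq_one.1 hfix)
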